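/- Let $d, s, k, c$ be non-negative integers. A moving point in $\mathbb{R}^d$ is a function $p:[0,\infty)\to\mathbb{R}^d$; it has description complexity $s$ if each of its $d$ coordinates is a real univariate polynomial of degree at most $s$ in the time $t$. A range $r\subseteq\mathbb{R}^d$ has description complexity $(k,c)$ if it is a Boolean combination of at most $k$ polynomial equations and inequalities in $d$ real variables, each of total degree at most $c$. For a finite set $P$ of moving points and a (possibly infinite) family $\mathcal{R}$ of ranges, the kinetic hypergraph $(P,\mathcal{R})$ has vertex set $P$, and its hyperedges are the sets $\{p\in P : p(t)\in r\}$ for all times $t\ge 0$ and all $r\in\mathcal{R}$. For a hypergraph with finite nonempty vertex set $V$, a nonempty subset $A\subseteq V$ is an $\varepsilon$-approximation if every hyperedge $S$ satisfies $\left|\frac{|S\cap A|}{|A|}-\frac{|S\cap V|}{|V|}\right|\le\varepsilon$. Theorem. There is a constant $C>0$, depending only on $d,s,k,c$, such that for every finite nonempty set $P$ of moving points in $\mathbb{R}^d$ of description complexity $s$, every family $\mathcal{R}$ of ranges in $\mathbb{R}^d$ of description complexity $(k,c)$, and every $\varepsilon\in(0,1]$, the kinetic hypergraph $(P,\mathcal{R})$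 admits an $\varepsilon$-approximation $A\subseteq P$ (a single set, valid for all times $t\ge 0$) with $|A|\le C/\varepsilon^2$. -/

import Mathlib

open scoped NNReal

/-- A moving point in `ℝ^d`: its position as a function of the time `t ∈ [0, ∞)`. -/
abbrev MovingPoint (d : ℕ) : Type := ℝ≥0 → EuclideanSpace ℝ (Fin d)

/-- The moving point `p` has description complexity `s`: every coordinate of its position is a
univariate polynomial of degree at most `s` in the time. -/
def MovingPoint.HasDescriptionComplexity {d : ℕ} (p : MovingPoint d) (s : ℕ) : Prop :=
  ∀ j : Fin d, ∃ q : Polynomial ℝ, q.natDegree ≤ s ∧ ∀ t : ℝ≥0, p t j = q.eval (t : ℝ)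

/-- A polynomial equation `f = 0` or inequality `f ≤ 0`, `f < 0` in `d` real variables
(the other directions are obtained from `-f` and from negation). -/
inductive PolyCondition (d : ℕ) : Type
  | eq (f : MvPolynomial (Fin d) ℝ)
  | le (f : MvPolynomial (Fin d) ℝ)
  | lt (f : MvPolynomial (Fin d) ℝ)

/-- The polynomial of a condition. -/
def PolyCondition.poly {d : ℕ} : PolyCondition d → MvPolynomial (Fin d) ℝ
  | .eq f => f
  | .le f => f
  | .lt f => f

/-- The point `x` satisfies the condition. -/
def PolyCondition.Holds {d : ℕ} : PolyCondition d → EuclideanSpace ℝ (Fin d) → Prop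
  | .eq f, x => MvPolynomial.eval (fun j => x j) f = 0
  | .le f, x => MvPolynomial.eval (fun j => x j) f ≤ 0
  | .lt f, x => MvPolynomial.eval (fun j => x j) f < 0

/-- The range `r ⊆ ℝ^d` is a Boolean combination of `k` polynomial equations and inequalities of
degree at most `c`. The Boolean combination is given by its truth function `Φ`; it may ignore some
of the `k` conditions, so that this says "at most `k`". -/
def RangeHasDescriptionComplexity {d : ℕ} (r : Set (EuclideanSpace ℝ (Fin d))) (k c : ℕ) : Prop :=
  ∃ (a : Fin k → PolyCondition d) (Φ : (Fin k → Prop) → Prop),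
    (∀ i, (a i).poly.totalDegree ≤ c) ∧ r = {x | Φ fun i => (a i).Holds x}

/-- The kinetic hypergraph of a set `P` of moving points and a family `R` of ranges: the vertices
are the moving points, and the hyperedges are the sets of all the points of `P` that lie in `r`
at time `t`, for a time `t ≥ 0` and a range `r ∈ R`. -/
def kineticHypergraph {d : ℕ} (P : Set (MovingPoint d))
    (R : Set (Set (EuclideanSpace ℝ (Fin d)))) : Hypergraph (MovingPoint d) where
  vertexSet := P
  edgeSet := {P' | ∃ t : ℝ≥0, ∃ r ∈ R, P' = {p ∈ P | p t ∈ r}}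
  subset_vertexSet_of_mem_edgeSet' := by
    rintro _ ⟨t, r, _, rfl⟩ p hp
    exact hp.1

/-- `A` is an `ε`-approximation of the hypergraph `H` (meant for a finite nonempty vertex set;
`A` is nonempty so that the density `|S ∩ A| / |A|` makes sense). -/
def IsEpsApproximation {α : Type*} (H : Hypergraph α) (ε : ℝ) (A : Set α) : Prop :=
  A ⊆ H.vertexSet ∧ A.Nonempty ∧ ∀ S ∈ H.edgeSet,
    |((S ∩ A).ncard : ℝ) / (A.ncard : ℝ)
      - ((S ∩ H.vertexSet).ncard : ℝ) / (H.vertexSet.ncard : ℝ)| ≤ ε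

/-! For a polynomial `f` of bounded degree, `f (p t)` is a linear functional of finitely many
coefficients attached to `p`; the time and `f` enter only through the weights
(`exists_linearization`). Hence hyperedges, over all times at once, are Boolean combinations of
boundedly many linear halfspaces, and Sauer–Shelah gives polynomially many traces
(`kinetic_hasPolynomialTraces`).

A union bound over all traces would cost a logarithm. Chaining avoids it: packing
(`card_le_of_separated`) gives small nets at all dyadic scales, random signs control every link
between consecutive nets, and summing along chains yields discrepancy `O(√m)` on `m` points
(`exists_low_discrepancy_signs`). Keeping one colour class at least halves the set and changes
densities by `O(1/√m)`. Iterated down to size about `1/ε²`, these errors form a geometric sum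
dominated by the last, of order `ε`. -/

/-- A set family `F` has at most `K * (r + 1) ^ D` traces on every sequence of `r` points. -/
def HasPolynomialTraces {α : Type*} (F : Set (Set α)) (K D : ℕ) : Prop :=
  ∀ (r : ℕ) (x : Fin r → α), ((fun S => x ⁻¹' S) '' F).ncard ≤ K * (r + 1) ^ D

/-! ### Traces of halfspaces and of their Boolean combinations -/

/-- A set of points that is shattered by open linear halfspaces has at most as many elements as
the dimension. -/
theorem card_le_of_shattered_by_halfspaces {ι κ : Type*} [Fintype ι] (y : κ → ι → ℝ)
    (s : Finset κ)
    (h : ∀ t ⊆ s, ∃ w : ι → ℝ, ∀ i ∈ s, i ∈ t ↔ w ⬝ᵥ y i < 0) :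
    s.card ≤ Fintype.card ι := by
  classical
  by_contra! hlt
  have hdep : ¬ LinearIndependent ℝ (fun i : s => y i) := by
    intro hli
    have := hli.fintype_card_le_finrank
    simp only [Fintype.card_coe, Module.finrank_fintype_fun_eq_card] at this
    omega
  rw [Fintype.not_linearIndependent_iff] at hdep
  obtain ⟨g, hg, i₀, hi₀⟩ := hdep
  obtain ⟨g, hg, i₀, hi₀⟩ : ∃ g : s → ℝ, ∑ i, g i • y i = 0 ∧ ∃ i, 0 < g i := by
    rcases lt_or_gt_of_ne hi₀ with hneg | hpos
    · refine ⟨-g, ?_, i₀, by simpa using hneg⟩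
      simpa only [Pi.neg_apply, neg_smul, Finset.sum_neg_distrib, neg_eq_zero] using hg
    · exact ⟨g, hg, i₀, hpos⟩
  -- Cutting out exactly the points with positive coefficient makes every term of the vanishing sum
  -- nonpositive and the term of `i₀` negative.
  obtain ⟨w, hw⟩ := h (s.filter fun i => ∃ hi : i ∈ s, 0 < g ⟨i, hi⟩) (Finset.filter_subset _ _)
  have hw' : ∀ i : s, 0 < g i ↔ w ⬝ᵥ y i < 0 := by
    intro i
    rw [← hw i i.2]
    simp
  have hsum : ∑ i, g i * (w ⬝ᵥ y i) = 0 := by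
    have : w ⬝ᵥ (∑ i, g i • y i) = 0 := by rw [hg]; simp
    simpa [dotProduct_sum, dotProduct_smul] using this
  have hle : ∀ i ∈ Finset.univ, g i * (w ⬝ᵥ y i) ≤ 0 := by
    intro i _
    by_cases hi : 0 < g i
    · exact (mul_neg_of_pos_of_neg hi ((hw' i).1 hi)).le
    · exact mul_nonpos_of_nonpos_of_nonneg (not_lt.1 hi) (not_lt.1 fun h' => hi ((hw' i).2 h'))
  have := Finset.sum_lt_sum hle
    ⟨i₀, Finset.mem_univ _, mul_neg_of_pos_of_neg hi₀ ((hw' i₀).1 hi₀)⟩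
  rw [hsum] at this
  simp at this

theorem sum_choose_le_succ_pow (r n N : ℕ) (hn : n ≤ N) :
    ∑ j ∈ Finset.Iic n, r.choose j ≤ (r + 1) ^ N := by
  calc ∑ j ∈ Finset.Iic n, r.choose j ≤ ∑ j ∈ Finset.range (N + 1), r.choose j := by
        apply Finset.sum_le_sum_of_subset
        intro j hj
        simp only [Finset.mem_Iic, Finset.mem_range] at *
        omega
    _ ≤ ∑ j ∈ Finset.range (N + 1), r ^ j * 1 ^ (N - j) * N.choose j := by
        refine Finset.sum_le_sum fun j hj => ?_
        have h1 : r.choose j ≤ r ^ j := Nat.choose_le_pow _ _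
        have h2 : 1 ≤ N.choose j := Nat.choose_pos (by simp at hj; omega)
        simpa using Nat.mul_le_mul h1 h2
    _ = (r + 1) ^ N := (add_pow _ _ _).symm

/-- The traces of the open linear halfspaces on the points `y i`. -/
def halfspaceTraces {ι κ : Type*} [Fintype ι] (y : κ → ι → ℝ) : Set (Set κ) :=
  Set.range fun w : ι → ℝ => {i | w ⬝ᵥ y i < 0}

/-- Sauer–Shelah, with the VC dimension bounded by the dimension through
`card_le_of_shattered_by_halfspaces`. -/
theorem ncard_halfspaceTraces_le {ι : Type*} [Fintype ι] {r : ℕ} (y : Fin r → ι → ℝ) :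
    (halfspaceTraces y).ncard ≤ (r + 1) ^ Fintype.card ι := by
  classical
  let A : Finset (Finset (Fin r)) :=
    Finset.univ.filter fun T => ∃ w : ι → ℝ, ∀ i, i ∈ T ↔ w ⬝ᵥ y i < 0
  have hsub : halfspaceTraces y ⊆ (A.image fun T : Finset (Fin r) => (T : Set (Fin r)) : Finset _) := by
    rintro _ ⟨w, rfl⟩
    simp only [Finset.coe_image, Set.mem_image]
    refine ⟨Finset.univ.filter fun i => w ⬝ᵥ y i < 0, ?_, by ext; simp⟩
    simp only [A, Finset.coe_filter, Set.mem_ofPred_eq, Finset.mem_univ, true_and]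
    exact ⟨w, by simp⟩
  have hvc : A.vcDim ≤ Fintype.card ι := by
    refine Finset.sup_le fun s hs => card_le_of_shattered_by_halfspaces y s fun t ht => ?_
    obtain ⟨u, hu, hut⟩ := Finset.mem_shatterer.1 hs ht
    simp only [A, Finset.mem_filter, Finset.mem_univ, true_and] at hu
    obtain ⟨w, hw⟩ := hu
    refine ⟨w, fun i hi => ?_⟩
    rw [← hw, ← hut]
    simp [hi]
  calc (halfspaceTraces y).ncard
      ≤ (A.image fun T : Finset (Fin r) => (T : Set (Fin r))).card := by
        rw [← Set.ncard_coe_finset]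
        exact Set.ncard_le_ncard hsub (Finset.finite_toSet _)
    _ ≤ A.card := Finset.card_image_le
    _ ≤ A.shatterer.card := Finset.card_le_card_shatterer A
    _ ≤ _ := Finset.card_shatterer_le_sum_vcDim
    _ ≤ (r + 1) ^ Fintype.card ι := by
        rw [Fintype.card_fin]
        exact sum_choose_le_succ_pow _ _ _ hvc

/-- Boolean combinations, with `k` pairs of arguments, of linear halfspaces have polynomially many
traces. -/
theorem hasPolynomialTraces_of_halfspaces {α ι : Type*} [Fintype ι] (u : α → ι → ℝ) (k : ℕ)
    (F : Set (Set α))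
    (hF : ∀ S ∈ F, ∃ (Ψ : (Fin k → Prop × Prop) → Prop) (w : Fin k → ι → ℝ),
      ∀ p, p ∈ S ↔ Ψ fun i => (w i ⬝ᵥ u p < 0, (-w i) ⬝ᵥ u p < 0)) :
    HasPolynomialTraces F (Nat.card ((Fin k → Prop × Prop) → Prop))
      (2 * Fintype.card ι * k) := by
  intro r x
  let H := halfspaceTraces (u ∘ x)
  -- A trace is determined by `Ψ` and `2 * k` halfspace traces, which gives the constant and the
  -- exponent.
  let G : ((Fin k → Prop × Prop) → Prop) × (Fin k → H × H) → Set (Fin r) :=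
    fun q => {i | q.1 fun j => (i ∈ (q.2 j).1.1, i ∈ (q.2 j).2.1)}
  have hsub : ((fun S => x ⁻¹' S) '' F) ⊆ Set.range G := by
    rintro _ ⟨S, hS, rfl⟩
    obtain ⟨Ψ, w, hw⟩ := hF S hS
    refine ⟨(Ψ, fun j => (⟨_, w j, rfl⟩, ⟨_, -w j, rfl⟩)), ?_⟩
    ext i
    simp [G, hw]
  have hHcard : Nat.card H ≤ (r + 1) ^ Fintype.card ι := by
    rw [Nat.card_coe_set_eq]
    exact ncard_halfspaceTraces_le _
  calc ((fun S => x ⁻¹' S) '' F).ncard ≤ (Set.range G).ncard :=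
        Set.ncard_le_ncard hsub (Set.toFinite _)
    _ ≤ Nat.card (((Fin k → Prop × Prop) → Prop) × (Fin k → H × H)) := by
        rw [← Nat.card_coe_set_eq]
        exact Finite.card_range_le G
    _ = Nat.card ((Fin k → Prop × Prop) → Prop) * (Nat.card H * Nat.card H) ^ k := by
        rw [Nat.card_prod, Nat.card_fun (α := Fin k), Nat.card_prod, Nat.card_fin]
    _ ≤ Nat.card ((Fin k → Prop × Prop) → Prop) * (r + 1) ^ (2 * Fintype.card ι * k) := by
        refine Nat.mul_le_mul_left _ ?_
        rw [pow_mul]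
        refine Nat.pow_le_pow_left ?_ k
        rw [two_mul, pow_add]
        exact Nat.mul_le_mul hHcard hHcard

/-! ### Linearization along moving points -/

/-- The values of a polynomial of degree at most `c` along moving points of description complexity
`s` at a fixed time depend linearly on finitely many features of the moving points. -/
theorem exists_linearization (d s c : ℕ) :
    ∃ N : ℕ, ∀ P : Set (MovingPoint d), (∀ p ∈ P, p.HasDescriptionComplexity s) →
      ∃ u : P → Fin N → ℝ, ∀ (f : MvPolynomial (Fin d) ℝ), f.totalDegree ≤ c → ∀ t : ℝ≥0,
        ∃ w : Fin N → ℝ, ∀ p : P,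
          MvPolynomial.eval (fun j => p.1 t j) f = w ⬝ᵥ u p := by
  classical
  -- The box of exponents at most `c` contains every monomial of total degree at most `c`; along a
  -- moving point such a monomial has degree at most `d * (c * s)` in the time.
  let B : Finset (Fin d →₀ ℕ) := Finset.Iic (Finsupp.equivFunOnFinite.symm fun _ => c)
  let I := B × Fin (d * (c * s) + 1)
  refine ⟨Fintype.card I, fun P hP => ?_⟩
  let e : Fin (Fintype.card I) ≃ I := (Fintype.equivFin I).symm
  choose q hqdeg hq using hP
  let u : P → I → ℝ := fun p i => (∏ j, q p.1 p.2 j ^ (i.1.1 j)).coeff i.2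
  refine ⟨fun p => u p ∘ e, fun f hf t => ?_⟩
  -- The time sits in the weight, not in the feature `u`, so one feature map serves all times.
  let w : I → ℝ := fun i => f.coeff i.1.1 * (t : ℝ) ^ (i.2 : ℕ)
  refine ⟨w ∘ e, fun p => ?_⟩
  rw [comp_equiv_dotProduct_comp_equiv]
  have hsupp : f.support ⊆ B := by
    intro a ha
    simp only [B, Finset.mem_Iic]
    intro j
    simp only [Finsupp.equivFunOnFinite_symm_apply_apply]
    have h1 := MvPolynomial.le_totalDegree ha
    have h2 : a j ≤ a.sum fun _ e => e := by
      by_cases hj : j ∈ a.support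
      · exact Finset.single_le_sum (f := fun i => a i) (fun _ _ => Nat.zero_le _) hj
      · simp [Finsupp.notMem_support_iff.1 hj]
    omega
  rw [MvPolynomial.eval_eq']
  rw [Finset.sum_subset hsupp (fun a _ ha => by
    rw [MvPolynomial.notMem_support_iff.1 ha, zero_mul])]
  rw [dotProduct, Fintype.sum_prod_type, ← Finset.sum_coe_sort B]
  refine Finset.sum_congr rfl fun a _ => ?_
  have hdeg : (∏ j, q p.1 p.2 j ^ (a.1 j)).natDegree < d * (c * s) + 1 := by
    refine Nat.lt_succ_of_le ((Polynomial.natDegree_prod_le _ _).trans ?_)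
    calc ∑ j, (q p.1 p.2 j ^ (a.1 j)).natDegree ≤ ∑ _j : Fin d, c * s := by
          refine Finset.sum_le_sum fun j _ => Polynomial.natDegree_pow_le.trans ?_
          have : a.1 j ≤ c := by
            have := Finset.mem_Iic.1 a.2 j
            simpa using this
          exact Nat.mul_le_mul this (hqdeg _ _ _)
      _ = d * (c * s) := by simp
  have heval : ∏ j, p.1 t j ^ (a.1 j) = (∏ j, q p.1 p.2 j ^ (a.1 j)).eval (t : ℝ) := by
    rw [Polynomial.eval_prod]
    simp [hq p.1 p.2]
  rw [heval, Polynomial.eval_eq_sum_range' hdeg, Finset.sum_range, Finset.mul_sum]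
  refine Finset.sum_congr rfl fun l _ => ?_
  simp only [w, u]
  ring

theorem kinetic_hasPolynomialTraces (d s k c : ℕ) :
    ∃ K D : ℕ, ∀ P : Set (MovingPoint d), (∀ p ∈ P, p.HasDescriptionComplexity s) →
      ∀ R : Set (Set (EuclideanSpace ℝ (Fin d))),
        (∀ r ∈ R, RangeHasDescriptionComplexity r k c) →
        HasPolynomialTraces {S : Set P | ∃ t : ℝ≥0, ∃ r ∈ R, S = {p : P | p.1 t ∈ r}} K D := by
  obtain ⟨N, hN⟩ := exists_linearization d s c
  refine ⟨Nat.card ((Fin k → Prop × Prop) → Prop), 2 * Fintype.card (Fin N) * k,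
    fun P hP R hR => ?_⟩
  obtain ⟨u, hu⟩ := hN P hP
  refine hasPolynomialTraces_of_halfspaces u k _ ?_
  rintro _ ⟨t, r, hr, rfl⟩
  obtain ⟨a, Φ, ha, rfl⟩ := hR r hr
  choose w hw using fun i => hu (a i).poly (ha i) t
  -- Recovers `f = 0`, `f ≤ 0`, `f < 0` from the truth values of `f < 0` and `-f < 0`.
  let D : PolyCondition d → Prop × Prop → Prop := fun
    | .eq _ => fun b => ¬ b.1 ∧ ¬ b.2
    | .le _ => fun b => ¬ b.2
    | .lt _ => fun b => b.1
  refine ⟨fun b => Φ fun i => D (a i) (b i), w, fun p => ?_⟩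
  have hD : ∀ i, (a i).Holds (p.1 t) = D (a i) (w i ⬝ᵥ u p < 0, (-w i) ⬝ᵥ u p < 0) := by
    intro i
    have h := hw i p
    revert h
    rcases a i with f | f | f <;> intro h <;>
      simp only [PolyCondition.poly] at h <;>
      simp only [D, PolyCondition.Holds, h, neg_dotProduct, neg_lt_zero, not_lt, eq_iff_iff]
    exact ⟨fun h => ⟨h.ge, h.le⟩, fun h => le_antisymm h.2 h.1⟩
  simp only [Set.mem_ofPred_eq, hD]

/-! ### Packing -/

/-- A random sequence of `r` points separates all the pairs of a `δ`-separated family. -/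
theorem exists_separating_sequence {α : Type*} [DecidableEq α] (A : Finset α) (hA : A.Nonempty)
    (F : Finset (Finset α)) (hFA : ∀ T ∈ F, T ⊆ A) (δ : ℝ)
    (hsep : ∀ S ∈ F, ∀ T ∈ F, S ≠ T → δ * A.card ≤ (symmDiff S T).card) (r : ℕ)
    (hr : (F.card : ℝ) ^ 2 * Real.exp (-(δ * r)) < 1) :
    ∃ x : Fin r → α, (∀ i, x i ∈ A) ∧
      ∀ S ∈ F, ∀ T ∈ F, S ≠ T → ∃ i, x i ∈ symmDiff S T := by
  classical
  by_contra! hcon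
  -- Union bound by counting: the sequences missing a given symmetric difference form at most a
  -- fraction `(1 - δ) ^ r ≤ exp (-(δ * r))` of all sequences in `A`.
  let Bad : Finset α × Finset α → Finset (Fin r → α) :=
    fun q => Fintype.piFinset fun _ => A \ symmDiff q.1 q.2
  have hcover : Fintype.piFinset (fun _ : Fin r => A) ⊆ F.offDiag.biUnion Bad := by
    intro x hx
    have hx' : ∀ i, x i ∈ A := Fintype.mem_piFinset.1 hx
    obtain ⟨S, hS, T, hT, hne, h⟩ := hcon x hx'
    refine Finset.mem_biUnion.2 ⟨(S, T), Finset.mem_offDiag.2 ⟨hS, hT, hne⟩, ?_⟩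
    exact Fintype.mem_piFinset.2 fun i => Finset.mem_sdiff.2 ⟨hx' i, h i⟩
  have hm : (0 : ℝ) < A.card := by exact_mod_cast hA.card_pos
  have hbad : ∀ q ∈ F.offDiag,
      ((Bad q).card : ℝ) ≤ (A.card : ℝ) ^ r * Real.exp (-(δ * r)) := by
    rintro ⟨S, T⟩ hq
    obtain ⟨hS, hT, hne⟩ := Finset.mem_offDiag.1 hq
    have hsubset : symmDiff S T ⊆ A := by
      intro a ha
      rcases Finset.mem_symmDiff.1 ha with h | h
      · exact hFA S hS h.1
      · exact hFA T hT h.1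
    have hcard : ((A \ symmDiff S T).card : ℝ) ≤ A.card * Real.exp (-δ) := by
      rw [Finset.cast_card_sdiff hsubset]
      have h1 := hsep S hS T hT hne
      have h2 := Real.add_one_le_exp (-δ)
      nlinarith
    have : ((Bad (S, T)).card : ℝ) = ((A \ symmDiff S T).card : ℝ) ^ r := by
      simp [Bad, Fintype.card_piFinset]
    rw [this]
    calc ((A \ symmDiff S T).card : ℝ) ^ r ≤ (A.card * Real.exp (-δ)) ^ r := by gcongr
      _ = _ := by rw [mul_pow, ← Real.exp_nat_mul]; ring_nf
  have h1 : (A.card : ℝ) ^ r ≤ ∑ q ∈ F.offDiag, ((Bad q).card : ℝ) := by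
    have := (Finset.card_le_card hcover).trans Finset.card_biUnion_le
    simp only [Fintype.card_piFinset, Finset.prod_const, Finset.card_univ, Fintype.card_fin] at this
    exact_mod_cast this
  have h2 : ∑ q ∈ F.offDiag, ((Bad q).card : ℝ)
      ≤ (F.card : ℝ) ^ 2 * ((A.card : ℝ) ^ r * Real.exp (-(δ * r))) := by
    refine (Finset.sum_le_card_nsmul _ _ _ hbad).trans ?_
    rw [nsmul_eq_mul]
    gcongr
    rw [Finset.offDiag_card]
    have : F.card * F.card - F.card ≤ F.card ^ 2 := by rw [sq]; exact Nat.sub_le _ _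
    exact_mod_cast this
  have hpos : (0 : ℝ) < (A.card : ℝ) ^ r := by positivity
  nlinarith

/-- A `δ`-separated family with polynomially many traces has at most polynomially many members
in `1 / δ`. -/
theorem card_le_of_separated {α : Type*} [DecidableEq α] {𝓕 : Set (Set α)} {K D : ℕ}
    (hD : 1 ≤ D) (h𝓕 : HasPolynomialTraces 𝓕 K D)
    (A : Finset α) (hA : A.Nonempty)
    (F : Finset (Finset α)) (hF : ∀ T ∈ F, ∃ S ∈ 𝓕, ∀ a, a ∈ T ↔ a ∈ A ∧ a ∈ S)
    (δ : ℝ) (hδ : 0 < δ) (hδ1 : δ ≤ 1)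
    (hsep : ∀ S ∈ F, ∀ T ∈ F, S ≠ T → δ * A.card ≤ (symmDiff S T).card) :
    (F.card : ℝ) ≤ (K * (4 * D + 3) ^ D) ^ 2 * (1 / δ) ^ (2 * D) := by
  classical
  rcases F.eq_empty_or_nonempty with rfl | hFne
  · simp only [Finset.card_empty, Nat.cast_zero]; positivity
  set n : ℝ := (F.card : ℝ) with hn
  have hn1 : 1 ≤ n := by rw [hn]; exact_mod_cast hFne.card_pos
  -- Just above `2 * log n / δ`, so that `n ^ 2 * exp (-(δ * r)) < 1`.
  set r : ℕ := ⌊2 * Real.log n / δ⌋₊ + 1 with hr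
  have hlog : 0 ≤ Real.log n := Real.log_nonneg hn1
  have hr1 : 2 * Real.log n / δ < r := by rw [hr]; exact_mod_cast Nat.lt_floor_add_one _
  have hr2 : (r : ℝ) ≤ 2 * Real.log n / δ + 1 := by
    rw [hr]; push_cast
    gcongr
    exact Nat.floor_le (by positivity)
  obtain ⟨x, hxA, hx⟩ := exists_separating_sequence A hA F
    (fun T hT a ha => by obtain ⟨S, -, hS⟩ := hF T hT; exact ((hS a).1 ha).1) δ hsep r (by
      rw [← hn]
      have : n ^ 2 = Real.exp (2 * Real.log n) := by
        rw [mul_comm, Real.exp_mul, Real.exp_log (by linarith)]; norm_num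
      rw [this, ← Real.exp_add, Real.exp_lt_one_iff]
      rw [div_lt_iff₀ hδ] at hr1
      linarith)
  -- The sequence separates the members of `F`, so they have distinct traces on it.
  have hcount : F.card ≤ K * (r + 1) ^ D := by
    refine le_trans ?_ (h𝓕 r x)
    rw [← Set.ncard_coe_finset]
    refine Set.ncard_le_ncard_of_injOn (fun T : Finset α => x ⁻¹' (T : Set α)) ?_ ?_ (Set.toFinite _)
    · intro T hT
      obtain ⟨S, hS, hST⟩ := hF T hT
      refine ⟨S, hS, ?_⟩
      ext i
      simp [hST, hxA]
    · intro S hS T hT hEq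
      by_contra hne
      obtain ⟨i, hi⟩ := hx S hS T hT hne
      have : x i ∈ S ↔ x i ∈ T := by simpa using Set.ext_iff.1 hEq i
      rw [Finset.mem_symmDiff] at hi
      tauto
  have hcount' : n ≤ K * ((r : ℝ) + 1) ^ D := by rw [hn]; exact_mod_cast hcount
  have hD0 : (0 : ℝ) < D := by exact_mod_cast hD
  -- Here `log n = 2 * D * log z ≤ 2 * D * z`, so the logarithm in `r` costs only a factor `z ^ D`
  -- against `n = z ^ (2 * D)`. The price is the exponent `2 * D` in place of about `D`, which is
  -- harmless for chaining.
  set z : ℝ := n ^ (1 / (2 * D : ℝ)) with hz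
  have hz1 : 1 ≤ z := Real.one_le_rpow hn1 (by positivity)
  have hzn : z ^ (2 * D) = n := by
    rw [hz, ← Real.rpow_natCast, ← Real.rpow_mul (by linarith)]
    push_cast
    rw [one_div_mul_cancel (by positivity), Real.rpow_one]
  have hlogz : Real.log n ≤ 2 * D * z := by
    rw [← hzn, Real.log_pow]
    push_cast
    have := Real.log_le_self (by linarith : 0 ≤ z)
    gcongr
  have hδ' : 1 ≤ 1 / δ := by rw [le_div_iff₀ hδ]; linarith
  have hr3 : (r : ℝ) + 1 ≤ (4 * D + 3) * z * (1 / δ) := by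
    have h1 : 2 * Real.log n / δ ≤ 4 * D * z * (1 / δ) := by
      rw [div_eq_mul_one_div]
      exact mul_le_mul_of_nonneg_right (by linarith) (by positivity)
    have h2 : 1 ≤ z * (1 / δ) := one_le_mul_of_one_le_of_one_le hz1 hδ'
    nlinarith
  have hmain : z ^ D * z ^ D ≤ (K * (4 * D + 3) ^ D * (1 / δ) ^ D) * z ^ D := by
    calc z ^ D * z ^ D = n := by rw [← hzn, two_mul, pow_add]
      _ ≤ K * ((4 * D + 3) * z * (1 / δ)) ^ D := hcount'.trans (by gcongr)
      _ = _ := by rw [mul_pow, mul_pow]; ring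
  have hzD : 0 < z ^ D := by positivity
  have hfin := le_of_mul_le_mul_right hmain hzD
  calc n = (z ^ D) ^ 2 := by rw [← hzn, ← pow_mul, mul_comm]
    _ ≤ (K * (4 * D + 3) ^ D * (1 / δ) ^ D) ^ 2 := by gcongr
    _ = _ := by rw [mul_pow, ← pow_mul, mul_comm D 2]

/-! ### Tail bounds for random signs -/

/-- The unnormalized moment generating function factors over the independent signs, and `cosh x ≤
exp (x ^ 2 / 2)` bounds each factor. -/
theorem sum_exp_signed_sum_le {α : Type*} [Fintype α] [DecidableEq α] (v : α → ℝ) (θ σ : ℝ)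
    (h : ∑ a, v a ^ 2 ≤ σ) :
    ∑ χ : α → Bool, Real.exp (θ * ∑ a, (if χ a then 1 else -1) * v a)
      ≤ 2 ^ Fintype.card α * Real.exp (θ ^ 2 * σ / 2) := by
  have h1 : ∀ χ : α → Bool, Real.exp (θ * ∑ a, (if χ a then 1 else -1) * v a)
      = ∏ a, Real.exp (θ * ((if χ a then 1 else -1) * v a)) := by
    intro χ
    rw [Finset.mul_sum, Real.exp_sum]
  simp_rw [h1]
  rw [← Fintype.prod_sum fun a (b : Bool) => Real.exp (θ * ((if b then 1 else -1) * v a))]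
  have h2 : ∀ a, ∑ b : Bool, Real.exp (θ * ((if b then 1 else -1) * v a))
      ≤ 2 * Real.exp (θ ^ 2 * v a ^ 2 / 2) := by
    intro a
    have := Real.cosh_le_exp_half_sq (θ * v a)
    rw [Real.cosh_eq, mul_pow] at this
    simp only [Fintype.sum_bool, if_true, one_mul, Bool.false_eq_true, if_false, neg_mul, mul_neg]
    linarith
  calc ∏ a, ∑ b : Bool, Real.exp (θ * ((if b then 1 else -1) * v a))
      ≤ ∏ a, 2 * Real.exp (θ ^ 2 * v a ^ 2 / 2) :=
        Finset.prod_le_prod (fun a _ => by positivity) fun a _ => h2 a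
    _ = 2 ^ Fintype.card α * Real.exp (∑ a, θ ^ 2 * v a ^ 2 / 2) := by
        rw [Finset.prod_mul_distrib, Real.exp_sum]; simp
    _ ≤ _ := by
        rw [← Finset.sum_div, ← Finset.mul_sum]
        gcongr

/-- Signs for which finitely many signed sums satisfy prescribed bounds, provided that the
Hoeffding tail bounds add up to less than one. -/
theorem exists_signs_of_sum_exp_lt_one {α ι : Type*} [Fintype α] (I : Finset ι)
    (v : ι → α → ℝ) (σ l : ι → ℝ) (hσ : ∀ i ∈ I, 0 < σ i) (hl : ∀ i ∈ I, 0 ≤ l i)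
    (hv : ∀ i ∈ I, ∑ a, v i a ^ 2 ≤ σ i)
    (hsum : ∑ i ∈ I, 2 * Real.exp (-(l i ^ 2 / (2 * σ i))) < 1) :
    ∃ χ : α → ℝ, (∀ a, χ a = 1 ∨ χ a = -1) ∧ ∀ i ∈ I, |∑ a, χ a * v i a| ≤ l i := by
  classical
  by_contra! hcon
  let X : ι → (α → Bool) → ℝ := fun i χ => ∑ a, (if χ a then 1 else -1) * v i a
  -- The minimizer of the Chernoff exponent `-θ * l + θ ^ 2 * σ / 2`.
  let θ : ι → ℝ := fun i => l i / σ i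
  have hone : ∀ χ : α → Bool, 1 ≤ ∑ i ∈ I, Real.exp (-(θ i * l i)) *
      (Real.exp (θ i * X i χ) + Real.exp (-θ i * X i χ)) := by
    intro χ
    obtain ⟨i, hi, hX⟩ := hcon (fun a => if χ a then 1 else -1) (fun a => by by_cases h : χ a <;> simp [h])
    have hθ : 0 ≤ θ i := div_nonneg (hl i hi) (hσ i hi).le
    refine le_trans ?_ (Finset.single_le_sum (f := fun i => Real.exp (-(θ i * l i)) *
      (Real.exp (θ i * X i χ) + Real.exp (-θ i * X i χ))) (fun j _ => by positivity) hi)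
    change l i < |X i χ| at hX
    have key : Real.exp (θ i * l i) ≤ Real.exp (θ i * X i χ) + Real.exp (-θ i * X i χ) := by
      rcases lt_abs.1 hX with h | h
      · have : Real.exp (θ i * l i) ≤ Real.exp (θ i * X i χ) := by gcongr
        linarith [Real.exp_pos (-θ i * X i χ)]
      · have : Real.exp (θ i * l i) ≤ Real.exp (-θ i * X i χ) := by
          apply Real.exp_le_exp.2
          nlinarith
        linarith [Real.exp_pos (θ i * X i χ)]
    calc (1 : ℝ) = Real.exp (-(θ i * l i)) * Real.exp (θ i * l i) := by
          rw [← Real.exp_add]; simp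
      _ ≤ _ := by gcongr
  have htotal : (2 : ℝ) ^ Fintype.card α ≤ ∑ χ : α → Bool, ∑ i ∈ I, Real.exp (-(θ i * l i)) *
      (Real.exp (θ i * X i χ) + Real.exp (-θ i * X i χ)) := by
    have := Finset.sum_le_sum fun χ (_ : χ ∈ (Finset.univ : Finset (α → Bool))) => hone χ
    simpa using this
  rw [Finset.sum_comm] at htotal
  have hbound : ∀ i ∈ I, ∑ χ : α → Bool, Real.exp (-(θ i * l i)) *
      (Real.exp (θ i * X i χ) + Real.exp (-θ i * X i χ))
      ≤ 2 ^ Fintype.card α * (2 * Real.exp (-(l i ^ 2 / (2 * σ i)))) := by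
    intro i hi
    have h1 := sum_exp_signed_sum_le (v i) (θ i) (σ i) (hv i hi)
    have h2 := sum_exp_signed_sum_le (v i) (-θ i) (σ i) (hv i hi)
    rw [neg_sq] at h2
    rw [← Finset.mul_sum, Finset.sum_add_distrib]
    have hσi := hσ i hi
    have hexp : Real.exp (-(l i ^ 2 / (2 * σ i)))
        = Real.exp (-(θ i * l i)) * Real.exp (θ i ^ 2 * σ i / 2) := by
      rw [← Real.exp_add]
      congr 1
      simp only [θ]
      field_simp
      ring
    rw [hexp]
    calc _ ≤ Real.exp (-(θ i * l i)) * (2 ^ Fintype.card α * Real.exp (θ i ^ 2 * σ i / 2)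
          + 2 ^ Fintype.card α * Real.exp (θ i ^ 2 * σ i / 2)) := by gcongr
      _ = _ := by ring
  have hfin := htotal.trans (Finset.sum_le_sum hbound)
  rw [← Finset.mul_sum] at hfin
  have hpos : (0 : ℝ) < 2 ^ Fintype.card α := by positivity
  nlinarith

/-! ### Dyadic nets and chaining -/

/-- A separated subfamily of maximum cardinality is a net, since a set farther than `ρ` from all its
members could be added. -/
theorem exists_separated_net {α : Type*} [DecidableEq α] (G : Finset (Finset α)) (ρ : ℝ)
    (hρ : 0 ≤ ρ) :
    ∃ F ⊆ G, (∀ S ∈ F, ∀ T ∈ F, S ≠ T → ρ ≤ (symmDiff S T).card) ∧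
      ∀ T ∈ G, ∃ S ∈ F, ((symmDiff S T).card : ℝ) ≤ ρ := by
  classical
  let Q := G.powerset.filter fun F => ∀ S ∈ F, ∀ T ∈ F, S ≠ T → ρ ≤ (symmDiff S T).card
  have hQ : Q.Nonempty := ⟨∅, by simp [Q]⟩
  obtain ⟨F, hFQ, hmax⟩ := Finset.exists_max_image Q Finset.card hQ
  obtain ⟨hFG, hsep⟩ := Finset.mem_filter.1 hFQ
  rw [Finset.mem_powerset] at hFG
  refine ⟨F, hFG, hsep, fun T hT => ?_⟩
  by_contra! hcon
  have hTF : T ∉ F := fun h => by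
    have := hcon T h
    simp only [symmDiff_self, Finset.bot_eq_empty, Finset.card_empty, Nat.cast_zero] at this
    linarith
  have hins : insert T F ∈ Q := by
    refine Finset.mem_filter.2 ⟨Finset.mem_powerset.2 (Finset.insert_subset hT hFG), ?_⟩
    intro A hA B hB hne
    rcases Finset.mem_insert.1 hA with hA | hA <;> rcases Finset.mem_insert.1 hB with hB | hB
    · exact absurd (hA.trans hB.symm) hne
    · rw [hA, symmDiff_comm]; exact (hcon B hB).le
    · rw [hB]; exact (hcon A hA).le
    · exact hsep A hA B hB hne
  have := hmax _ hins
  rw [Finset.card_insert_of_notMem hTF] at this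
  omega

/-- Nets at all dyadic scales for the traces of a family on a finite set. -/
theorem exists_dyadic_nets {α : Type*} [DecidableEq α] {𝓕 : Set (Set α)} {K D : ℕ}
    (hD : 1 ≤ D) (h𝓕 : HasPolynomialTraces 𝓕 K D)
    (A : Finset α) (hA : A.Nonempty)
    (G : Finset (Finset α)) (hG : ∀ T ∈ G, ∃ S ∈ 𝓕, ∀ a, a ∈ T ↔ a ∈ A ∧ a ∈ S) (j : ℕ) :
    ∃ (E : Finset (Finset α)) (π : Finset α → Finset α), (j = 0 → ∀ T, π T = ∅) ∧
      (E.card : ℝ) ≤ ((K * (4 * D + 3) ^ D) ^ 2 + 1) * (2 ^ j) ^ (2 * D) ∧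
      ∀ T ∈ G, π T ∈ E ∧ ((symmDiff (π T) T).card : ℝ) ≤ A.card * (1 / 2) ^ j := by
  classical
  rcases j with _ | j
  -- At scale zero the net is `{∅}`, so all chains start with signed sum `0`.
  · refine ⟨{∅}, fun _ => ∅, fun _ _ => rfl, ?_, fun T hT => ⟨by simp, ?_⟩⟩
    · simp only [Finset.card_singleton, Nat.cast_one, pow_zero, one_pow, mul_one]
      linarith [sq_nonneg ((K : ℝ) * (4 * D + 3) ^ D)]
    · obtain ⟨S, -, hS⟩ := hG T hT
      have : T ⊆ A := fun a ha => ((hS a).1 ha).1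
      rw [pow_zero, mul_one, ← Finset.bot_eq_empty, bot_symmDiff]
      exact_mod_cast Finset.card_le_card this
  · obtain ⟨F, hFG, hsep, hnet⟩ := exists_separated_net G ((1 / 2) ^ (j + 1) * (A.card : ℝ))
      (by positivity)
    choose! π hπ hπd using hnet
    refine ⟨F, π, fun h => absurd h (Nat.succ_ne_zero j), ?_, fun T hT => ⟨hπ T hT, ?_⟩⟩
    · refine (card_le_of_separated hD h𝓕 A hA F (fun T hT => hG T (hFG hT)) _ (by positivity)
        (pow_le_one₀ (by norm_num) (by norm_num)) hsep).trans ?_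
      have : (1 : ℝ) / (1 / 2) ^ (j + 1) = 2 ^ (j + 1) := by rw [one_div_pow, one_div_one_div]
      rw [this]
      gcongr
      linarith
    · rw [mul_comm]; exact hπd T hT

/-- Gives the variance parameter of a link: close sets have signed sums that differ by a random sum
of small variance. -/
theorem sum_sq_indicator_sub {α : Type*} [Fintype α] [DecidableEq α] (S T : Finset α) :
    ∑ a, ((if a ∈ T then (1 : ℝ) else 0) - (if a ∈ S then 1 else 0)) ^ 2
      = ((symmDiff S T).card : ℝ) := by
  rw [Finset.card_eq_sum_ones, Nat.cast_sum, ← Finset.sum_filter_add_sum_filter_not Finset.univ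
    (fun a => a ∈ symmDiff S T)]
  rw [Finset.sum_eq_zero (s := Finset.univ.filter fun a => ¬ a ∈ symmDiff S T), add_zero]
  · rw [Finset.filter_univ_mem]
    refine Finset.sum_congr rfl fun a ha => ?_
    rcases Finset.mem_symmDiff.1 ha with h | h <;> simp [h]
  · intro a ha
    have := (Finset.mem_filter.1 ha).2
    rw [Finset.mem_symmDiff] at this
    by_cases h1 : a ∈ S <;> by_cases h2 : a ∈ T <;> simp_all

open Classical in
/-- A set family with polynomially many traces has discrepancy `O(√m)` on every set of `m`
points. -/
theorem exists_low_discrepancy_signs (K D : ℕ) (hD : 1 ≤ D) :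
    ∃ C : ℝ, 0 < C ∧ ∀ {α : Type*} [Fintype α] {𝓕 : Set (Set α)}, HasPolynomialTraces 𝓕 K D →
      ∀ A : Finset α, A.Nonempty →
      ∃ χ : α → ℝ, (∀ a, χ a = 1 ∨ χ a = -1) ∧
        ∀ S ∈ 𝓕, |∑ a ∈ A.filter (· ∈ S), χ a| ≤ C * √(A.card : ℝ) := by
  set K' : ℝ := ((K : ℝ) * (4 * D + 3) ^ D) ^ 2 + 1 with hK'
  have hK1 : 1 ≤ K' := by rw [hK']; linarith [sq_nonneg ((K : ℝ) * (4 * D + 3) ^ D)]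
  -- Level `j` has at most `K' ^ 2 * (16 ^ D) ^ (j + 1)` links, each failing with probability at
  -- most `2 * (1 / M) ^ (j + 1)`. This `M` makes the failures at level `j` at most `1/4 * (1/2) ^
  -- j`.
  set M : ℝ := 8 * K' ^ 2 * 16 ^ D with hM
  have hM1 : 1 < M := by
    have h1 : (1 : ℝ) ≤ 16 ^ D := one_le_pow₀ (by norm_num)
    have h2 : 1 ≤ K' ^ 2 := one_le_pow₀ hK1
    nlinarith
  set b : ℝ := Real.log M with hb
  have hb0 : 0 < b := Real.log_pos hM1
  have hexpb : Real.exp (-b) = 1 / M := by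
    rw [Real.exp_neg, hb, Real.exp_log (by linarith), one_div]
  refine ⟨4 * √(32 * b), by positivity, fun {α} _ 𝓕 h𝓕 A hA => ?_⟩
  have hm : (0 : ℝ) < A.card := by exact_mod_cast hA.card_pos
  let G : Finset (Finset α) := Finset.univ.filter fun T => ∃ S ∈ 𝓕, ∀ a, a ∈ T ↔ a ∈ A ∧ a ∈ S
  have hG : ∀ T ∈ G, ∃ S ∈ 𝓕, ∀ a, a ∈ T ↔ a ∈ A ∧ a ∈ S := fun T hT => (Finset.mem_filter.1 hT).2
  choose E π hπ0 hE hπ using exists_dyadic_nets hD h𝓕 A hA G hG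
  let m := A.card
  let I : Finset (Σ _ : ℕ, Finset α × Finset α) := (Finset.range m).sigma fun j =>
    (E j ×ˢ E (j + 1)).filter fun q => ((symmDiff q.1 q.2).card : ℝ) ≤ 2 * A.card * (1 / 2) ^ j
  let v : (Σ _ : ℕ, Finset α × Finset α) → α → ℝ := fun i a =>
    (if a ∈ i.2.2 then (1 : ℝ) else 0) - (if a ∈ i.2.1 then 1 else 0)
  -- The ratio `3 / 4` lies between `√(1/2)` and `1`: the allowed deviations are summable, with sum
  -- at most `4`, while their squares over the variances grow like `(9 / 8) ^ j` and beat the number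
  -- of links.
  obtain ⟨χ, hχ, hχI⟩ := exists_signs_of_sum_exp_lt_one I v
    (fun i => 2 * A.card * (1 / 2) ^ i.1) (fun i => √(32 * b) * √(A.card : ℝ) * (3 / 4) ^ i.1)
    (fun i _ => by positivity) (fun i _ => by positivity)
    (fun i hi => by
      simp only [v]
      rw [sum_sq_indicator_sub]
      exact (Finset.mem_filter.1 (Finset.mem_sigma.1 hi).2).2)
    (by
      have hterm : ∀ j, Real.exp (-((√(32 * b) * √(A.card : ℝ) * (3 / 4) ^ j) ^ 2
          / (2 * (2 * A.card * (1 / 2) ^ j)))) ≤ (1 / M) ^ (j + 1) := by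
        intro j
        rw [← hexpb, ← Real.exp_nat_mul, Real.exp_le_exp]
        rw [mul_pow, mul_pow, Real.sq_sqrt (by positivity), Real.sq_sqrt hm.le]
        have : 32 * b * A.card * ((3 / 4) ^ j) ^ 2 / (2 * (2 * A.card * (1 / 2) ^ j))
            = 8 * b * (9 / 8) ^ j := by
          have h98 : (9 / 8 : ℝ) ^ j = ((3 / 4) ^ j) ^ 2 / (1 / 2) ^ j := by
            rw [← pow_mul, mul_comm j 2, pow_mul, ← div_pow]; norm_num
          rw [h98]
          field_simp
          ring
        rw [this]
        -- Bernoulli gives `8 * (9 / 8) ^ j ≥ 8 + j ≥ j + 1`.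
        have hbern := one_add_mul_le_pow (a := (1 / 8 : ℝ)) (by norm_num) j
        have h98 : (1 + 1 / 8 : ℝ) = 9 / 8 := by norm_num
        rw [h98] at hbern
        push_cast
        nlinarith
      have hcard : ∀ j, (((E j ×ˢ E (j + 1)).filter fun q =>
          ((symmDiff q.1 q.2).card : ℝ) ≤ 2 * A.card * (1 / 2) ^ j).card : ℝ)
          ≤ K' ^ 2 * (16 ^ D) ^ (j + 1) := by
        intro j
        have h1 : ((E j ×ˢ E (j + 1)).card : ℝ) = (E j).card * (E (j + 1)).card := by
          rw [Finset.card_product]; push_cast; rfl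
        calc _ ≤ ((E j ×ˢ E (j + 1)).card : ℝ) := by
              exact_mod_cast Finset.card_filter_le _ _
          _ ≤ (K' * (2 ^ j) ^ (2 * D)) * (K' * (2 ^ (j + 1)) ^ (2 * D)) := by
              rw [h1]
              exact mul_le_mul (hE j) (hE (j + 1)) (by positivity) (by positivity)
          _ ≤ (K' * (2 ^ (j + 1)) ^ (2 * D)) * (K' * (2 ^ (j + 1)) ^ (2 * D)) := by
              gcongr <;> norm_num
          _ = _ := by
              have : (16 : ℝ) = 2 ^ 4 := by norm_num
              rw [this, ← pow_mul, ← pow_mul, ← pow_mul]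
              ring
      rw [Finset.sum_sigma]
      calc _ ≤ ∑ j ∈ Finset.range m, (1 / 4 : ℝ) * (1 / 2) ^ j := by
            refine Finset.sum_le_sum fun j _ => ?_
            dsimp only
            rw [Finset.sum_const, nsmul_eq_mul]
            calc _ ≤ K' ^ 2 * (16 ^ D) ^ (j + 1) * (2 * (1 / M) ^ (j + 1)) :=
                  mul_le_mul (hcard j) (mul_le_mul_of_nonneg_left (hterm j) (by norm_num))
                    (by positivity) (by positivity)
              _ = 2 * K' ^ 2 * (1 / (8 * K' ^ 2)) ^ (j + 1) := by
                  have : (1 / (8 * K' ^ 2)) = 16 ^ D * (1 / M) := by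
                    rw [hM]; field_simp
                  rw [this, mul_pow]; ring
              _ = 1 / 4 * (1 / (8 * K' ^ 2)) ^ j := by
                  have : 2 * K' ^ 2 * (1 / (8 * K' ^ 2)) = 1 / 4 := by field_simp; norm_num
                  rw [pow_succ, ← this]; ring
              _ ≤ 1 / 4 * (1 / 2) ^ j := by
                  have h2 : 1 ≤ K' ^ 2 := one_le_pow₀ hK1
                  gcongr
                  linarith
        _ ≤ 1 / 4 * 2 := by
            rw [← Finset.mul_sum]
            exact mul_le_mul_of_nonneg_left (sum_geometric_two_le m) (by norm_num)
        _ < 1 := by norm_num)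
  refine ⟨χ, hχ, fun S hS => ?_⟩
  set T := A.filter (· ∈ S) with hT
  have hTG : T ∈ G := Finset.mem_filter.2 ⟨Finset.mem_univ _, S, hS, fun a => by simp [hT]⟩
  let X : Finset α → ℝ := fun U => ∑ a, χ a * (if a ∈ U then (1 : ℝ) else 0)
  have hX : ∑ a ∈ T, χ a = X T := by simp [X]
  have hstep : ∀ j ∈ Finset.range m, |X (π (j + 1) T) - X (π j T)|
      ≤ √(32 * b) * √(A.card : ℝ) * (3 / 4) ^ j := by
    intro j hj
    have hmem : (⟨j, (π j T, π (j + 1) T)⟩ : Σ _ : ℕ, Finset α × Finset α) ∈ I := by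
      refine Finset.mem_sigma.2 ⟨hj, Finset.mem_filter.2 ⟨Finset.mem_product.2
        ⟨(hπ j T hTG).1, (hπ (j + 1) T hTG).1⟩, ?_⟩⟩
      have h1 := (hπ j T hTG).2
      have h2 := (hπ (j + 1) T hTG).2
      have h3 : (symmDiff (π j T) (π (j + 1) T)).card
          ≤ (symmDiff (π j T) T).card + (symmDiff (π (j + 1) T) T).card := by
        rw [symmDiff_comm (π (j + 1) T)]
        exact (Finset.card_le_card (symmDiff_triangle (π j T) T (π (j + 1) T))).trans
          (Finset.card_union_le _ _)
      have h4 : ((symmDiff (π j T) (π (j + 1) T)).card : ℝ)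
          ≤ (symmDiff (π j T) T).card + (symmDiff (π (j + 1) T) T).card := by exact_mod_cast h3
      rw [pow_succ] at h2
      have h5 : 0 < (A.card : ℝ) * (1 / 2) ^ j := by positivity
      change ((symmDiff (π j T) (π (j + 1) T)).card : ℝ) ≤ 2 * A.card * (1 / 2) ^ j
      linarith
    have := hχI _ hmem
    simpa [v, X, mul_sub, Finset.sum_sub_distrib] using this
  -- After `m = A.card` levels the distance is below `1`, because `m < 2 ^ m`, so the chain has
  -- reached `T`.
  have hlast : π m T = T := by
    have h1 := (hπ m T hTG).2
    have h2 : (A.card : ℝ) * (1 / 2) ^ m < 1 := by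
      rw [one_div_pow, mul_one_div, div_lt_one (by positivity)]
      exact_mod_cast Nat.lt_two_pow_self
    have h3 : (symmDiff (π m T) T).card < 1 := by exact_mod_cast h1.trans_lt h2
    rw [Nat.lt_one_iff, Finset.card_eq_zero] at h3
    exact symmDiff_eq_bot.1 h3
  have hfirst : X (π 0 T) = 0 := by simp [X, hπ0 0 rfl]
  have htel : X T = ∑ j ∈ Finset.range m, (X (π (j + 1) T) - X (π j T)) := by
    rw [Finset.sum_range_sub (fun j => X (π j T)), hlast, hfirst, sub_zero]
  have hgeom : ∑ j ∈ Finset.range m, (3 / 4 : ℝ) ^ j ≤ 4 := by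
    rw [geom_sum_eq (by norm_num)]
    have : (0 : ℝ) ≤ (3 / 4) ^ m := by positivity
    rw [div_le_iff_of_neg (by norm_num)]
    linarith
  rw [hX, htel]
  calc _ ≤ ∑ j ∈ Finset.range m, |X (π (j + 1) T) - X (π j T)| := Finset.abs_sum_le_sum_abs _ _
    _ ≤ ∑ j ∈ Finset.range m, √(32 * b) * √(A.card : ℝ) * (3 / 4) ^ j := Finset.sum_le_sum hstep
    _ ≤ √(32 * b) * √(A.card : ℝ) * 4 := by
        rw [← Finset.mul_sum]
        gcongr
    _ = _ := by ring

/-! ### Halving -/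

/-- Serves to adjoin `Set.univ`, whose discrepancy controls the size of the colour classes. -/
theorem HasPolynomialTraces.insert {α : Type*} {F : Set (Set α)} {K D : ℕ}
    (h : HasPolynomialTraces F K D) (S : Set α) : HasPolynomialTraces (insert S F) (K + 1) D := by
  intro r x
  rw [Set.image_insert_eq]
  refine (Set.ncard_insert_le _ _).trans ?_
  rw [add_mul, one_mul]
  exact Nat.add_le_add (h r x) (Nat.one_le_pow _ _ (Nat.succ_pos r))

theorem HasPolynomialTraces.mono_exponent {α : Type*} {F : Set (Set α)} {K D D' : ℕ}
    (h : HasPolynomialTraces F K D) (hD : D ≤ D') : HasPolynomialTraces F K D' :=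
  fun r x => (h r x).trans (Nat.mul_le_mul_left _ (Nat.pow_le_pow_right (Nat.succ_pos r) hD))

open Classical in
/-- The density of `S` in the finite set `A`. -/
noncomputable def setDensity {α : Type*} (A : Finset α) (S : Set α) : ℝ :=
  ((A.filter (· ∈ S)).card : ℝ) / A.card

open Classical in
theorem card_filter_pos_of_signs {α : Type*} (B : Finset α) (χ : α → ℝ)
    (hχ : ∀ a, χ a = 1 ∨ χ a = -1) :
    ((B.filter fun a => χ a = 1).card : ℝ) = (B.card + ∑ a ∈ B, χ a) / 2 := by
  have h : ∀ a ∈ B, χ a = 2 * (if χ a = 1 then (1 : ℝ) else 0) - 1 := by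
    intro a _
    rcases hχ a with h | h <;> rw [h] <;> norm_num
  have h2 : ∑ a ∈ B, χ a = 2 * ((B.filter fun a => χ a = 1).card : ℝ) - B.card := by
    rw [Finset.sum_congr rfl h, Finset.sum_sub_distrib, ← Finset.mul_sum, Finset.sum_boole]
    simp
  linarith

open Classical in
/-- A low-discrepancy coloring yields a subset of at most half the size that has almost the same
densities. -/
theorem exists_halving {α : Type*} {𝓕 : Set (Set α)} {C : ℝ} (A : Finset α)
    (hC : 4 * C ^ 2 ≤ A.card) (hC0 : 0 < C)
    (hdisc : ∃ χ : α → ℝ, (∀ a, χ a = 1 ∨ χ a = -1) ∧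
        ∀ S ∈ insert Set.univ 𝓕, |∑ a ∈ A.filter (· ∈ S), χ a| ≤ C * √(A.card : ℝ)) :
    ∃ A' ⊆ A, A'.Nonempty ∧ (A'.card : ℝ) ≤ A.card / 2 ∧
      ∀ S ∈ 𝓕, |setDensity A' S - setDensity A S| ≤ 4 * C / √(A.card : ℝ) := by
  -- Up to a global sign change, the positive class is the smaller one.
  obtain ⟨χ, hχ, hS, huniv⟩ : ∃ χ : α → ℝ, (∀ a, χ a = 1 ∨ χ a = -1) ∧
      (∀ S ∈ insert Set.univ 𝓕, |∑ a ∈ A.filter (· ∈ S), χ a| ≤ C * √(A.card : ℝ)) ∧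
      ∑ a ∈ A, χ a ≤ 0 := by
    obtain ⟨χ, hχ, h⟩ := hdisc
    rcases le_total (∑ a ∈ A, χ a) 0 with hle | hle
    · exact ⟨χ, hχ, h, hle⟩
    · refine ⟨-χ, fun a => ?_, fun S hS => ?_, ?_⟩
      · rcases hχ a with h | h <;> simp [h]
      · simpa [Finset.sum_neg_distrib] using h S hS
      · simpa [Finset.sum_neg_distrib] using hle
  set m : ℝ := (A.card : ℝ) with hm
  have hm0 : 0 < m := lt_of_lt_of_le (by positivity) hC
  set D : ℝ := ∑ a ∈ A, χ a with hDdef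
  have hsq : √m * √m = m := Real.mul_self_sqrt hm0.le
  have hsqrt : 2 * C ≤ √m := Real.le_sqrt_of_sq_le (by linarith)
  have hsqrt0 : 0 < √m := Real.sqrt_pos.2 hm0
  have hDabs : |D| ≤ C * √m := by
    have := hS Set.univ (Set.mem_insert _ _)
    simpa using this
  -- The positive class keeps at least a quarter of the points; this is where `4 * C ^ 2 ≤ m`
  -- enters.
  have hDlow : m / 2 ≤ m + D := by
    have := (abs_le.1 hDabs).1
    nlinarith
  set A' := A.filter fun a => χ a = 1 with hA'
  have hcard : (A'.card : ℝ) = (m + D) / 2 := card_filter_pos_of_signs A χ hχ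
  refine ⟨A', Finset.filter_subset _ _, ?_, ?_, fun S hSF => ?_⟩
  · rw [← Finset.card_pos]
    have : (0 : ℝ) < A'.card := by rw [hcard]; linarith
    exact_mod_cast this
  · rw [hcard]; linarith
  · have hDS := hS S (Set.mem_insert_of_mem _ hSF)
    set DS : ℝ := ∑ a ∈ A.filter (· ∈ S), χ a with hDSdef
    set n : ℝ := ((A.filter (· ∈ S)).card : ℝ) with hn
    have hcardS : ((A'.filter (· ∈ S)).card : ℝ) = (n + DS) / 2 := by
      rw [hA', Finset.filter_comm]
      exact card_filter_pos_of_signs _ χ hχ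
    have hn0 : 0 ≤ n := by positivity
    have hnm : n ≤ m := by
      rw [hn, hm]
      exact_mod_cast Finset.card_filter_le _ _
    rw [setDensity, setDensity, hcardS, hcard, ← hm, ← hn]
    have hmD : 0 < m + D := by linarith
    have heq : (n + DS) / 2 / ((m + D) / 2) - n / m = (DS - n / m * D) / (m + D) := by
      field_simp
      ring
    rw [heq, abs_div, abs_of_pos hmD, div_le_div_iff₀ hmD hsqrt0]
    have hratio : |n / m * D| ≤ |D| := by
      rw [abs_mul, abs_of_nonneg (by positivity)]
      exact mul_le_of_le_one_left (abs_nonneg _) ((div_le_one hm0).2 hnm)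
    have habs : |DS - n / m * D| ≤ 2 * C * √m := by
      have := abs_sub DS (n / m * D)
      linarith
    calc |DS - n / m * D| * √m ≤ 2 * C * √m * √m := by gcongr
      _ = 2 * C * m := by rw [mul_assoc, hsq]
      _ ≤ 4 * C * (m + D) := by nlinarith

/-- Iterated halving: if every set of `m` points can be coloured with discrepancy `C √m`, then
there are `ε`-approximations of size `400 C² / ε²`. -/
theorem exists_approximation_of_discrepancy {α : Type*} {𝓕 : Set (Set α)} {C : ℝ} (hC0 : 0 < C)
    (hdisc : ∀ A : Finset α, A.Nonempty → ∃ A' ⊆ A, A'.Nonempty ∧ (4 * C ^ 2 ≤ A.card →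
      (A'.card : ℝ) ≤ A.card / 2 ∧
      ∀ S ∈ 𝓕, |setDensity A' S - setDensity A S| ≤ 4 * C / √(A.card : ℝ)))
    (M : ℝ) (hM : 4 * C ^ 2 ≤ M) (A : Finset α) (hA : A.Nonempty) (hAM : M < A.card) :
    ∃ B ⊆ A, B.Nonempty ∧ (B.card : ℝ) ≤ M ∧
      ∀ S ∈ 𝓕, |setDensity B S - setDensity A S| ≤ 10 * C * (2 / √M - 1 / √(A.card : ℝ)) := by
  -- The term `-1 / √A.card` makes the error telescope: halving costs `4 * C / √m`, and as `7/5 ≤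
  -- √2`, the bound for the smaller set is less by at least `10 * C * (7/5 - 1) / √m = 4 * C / √m`.
  induction hn : A.card using Nat.strong_induction_on generalizing A with
  | _ n ih =>
    subst hn
    have hM0 : 0 < M := lt_of_lt_of_le (by positivity) hM
    have hm0 : (0 : ℝ) < A.card := hM0.trans hAM
    obtain ⟨A', hA'A, hA'ne, h⟩ := hdisc A hA
    obtain ⟨hcard, herr⟩ := h (hM.trans hAM.le)
    have hsM : 0 < √M := Real.sqrt_pos.2 hM0
    have hsm : 0 < √(A.card : ℝ) := Real.sqrt_pos.2 hm0
    have hinv : 1 / √(A.card : ℝ) ≤ 1 / √M :=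
      one_div_le_one_div_of_le hsM (Real.sqrt_le_sqrt hAM.le)
    have h4 : 4 * C / √(A.card : ℝ) = 4 * C * (1 / √(A.card : ℝ)) := by rw [mul_one_div]
    have h2 : 2 / √M = 2 * (1 / √M) := by rw [mul_one_div]
    have hpos : 0 < 1 / √(A.card : ℝ) := by positivity
    rcases le_or_gt (A'.card : ℝ) M with hle | hgt
    · refine ⟨A', hA'A, hA'ne, hle, fun S hS => (herr S hS).trans ?_⟩
      rw [h4, h2]
      nlinarith
    · have hlt : A'.card < A.card := by
        have : (A'.card : ℝ) < A.card := by linarith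
        exact_mod_cast this
      obtain ⟨B, hBA', hBne, hBM, hB⟩ := ih A'.card hlt A' hA'ne hgt rfl
      refine ⟨B, hBA'.trans hA'A, hBne, hBM, fun S hS => ?_⟩
      have h1 := hB S hS
      have h3 := herr S hS
      have htri := abs_sub_le (setDensity B S) (setDensity A' S) (setDensity A S)
      have hm'0 : (0 : ℝ) < A'.card := hM0.trans hgt
      have hroot : 7 / 5 * (1 / √(A.card : ℝ)) ≤ 1 / √(A'.card : ℝ) := by
        rw [mul_one_div, div_le_div_iff₀ hsm (Real.sqrt_pos.2 hm'0), one_mul]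
        refine Real.le_sqrt_of_sq_le ?_
        rw [mul_pow, Real.sq_sqrt hm'0.le]
        linarith
      rw [h4] at h3
      nlinarith

theorem exists_approximation (K D : ℕ) :
    ∃ C : ℝ, 0 < C ∧ ∀ {α : Type*} [Fintype α] [Nonempty α] {𝓕 : Set (Set α)},
      HasPolynomialTraces 𝓕 K D → ∀ ε : ℝ, 0 < ε → ε ≤ 1 →
      ∃ B : Finset α, B.Nonempty ∧ (B.card : ℝ) ≤ C / ε ^ 2 ∧
        ∀ S ∈ 𝓕, |setDensity B S - setDensity Finset.univ S| ≤ ε := by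
  classical
  -- `K + 1` pays for adjoining `Set.univ`; `D + 1` ensures the positive exponent needed for
  -- packing.
  obtain ⟨C, hC0, hC⟩ := exists_low_discrepancy_signs (K + 1) (D + 1) (Nat.succ_pos D)
  refine ⟨400 * C ^ 2, by positivity, fun {α} _ _ 𝓕 h𝓕 ε hε hε1 => ?_⟩
  -- Chosen so that the main error term `20 * C / √M` equals `ε`.
  set M : ℝ := 400 * C ^ 2 / ε ^ 2 with hM
  rcases le_or_gt ((Finset.univ : Finset α).card : ℝ) M with hle | hgt
  · exact ⟨Finset.univ, Finset.univ_nonempty, hle, fun S _ => by simpa using hε.le⟩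
  have hdisc := hC ((h𝓕.mono_exponent (Nat.le_succ D)).insert Set.univ)
  have hC4 : 4 * C ^ 2 ≤ M := by
    rw [hM, le_div_iff₀ (by positivity)]
    have : ε ^ 2 ≤ 1 := pow_le_one₀ hε.le hε1
    nlinarith [sq_nonneg C]
  obtain ⟨B, -, hBne, hBM, hB⟩ := exists_approximation_of_discrepancy (𝓕 := 𝓕) hC0
    (fun A hA => by
      by_cases h : 4 * C ^ 2 ≤ A.card
      · obtain ⟨A', h1, h2, h3⟩ := exists_halving A h hC0 (hdisc A hA)
        exact ⟨A', h1, h2, fun _ => h3⟩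
      · exact ⟨A, Finset.Subset.refl A, hA, fun h' => absurd h' h⟩)
    M hC4 Finset.univ Finset.univ_nonempty hgt
  refine ⟨B, hBne, hBM, fun S hS => (hB S hS).trans ?_⟩
  have hsqrt : √M = 20 * C / ε := by
    rw [hM, show 400 * C ^ 2 / ε ^ 2 = (20 * C / ε) ^ 2 by ring]
    exact Real.sqrt_sq (by positivity)
  have hε' : 10 * C * (2 / √M) = ε := by
    rw [hsqrt]; field_simp; norm_num
  rw [mul_sub, hε']
  have : 0 ≤ 10 * C * (1 / √((Finset.univ : Finset α).card : ℝ)) := by positivity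
  linarith

/-! ### The kinetic hypergraph -/

theorem mainTheorem6 (d s k c : ℕ) :
    ∃ C : ℝ, 0 < C ∧
      ∀ (P : Set (MovingPoint d)), P.Finite → P.Nonempty →
        (∀ p ∈ P, p.HasDescriptionComplexity s) →
      ∀ (R : Set (Set (EuclideanSpace ℝ (Fin d)))),
        (∀ r ∈ R, RangeHasDescriptionComplexity r k c) →
      ∀ ε : ℝ, 0 < ε → ε ≤ 1 →
        ∃ A : Set (MovingPoint d),
          IsEpsApproximation (kineticHypergraph P R) ε A ∧ (A.ncard : ℝ) ≤ C / ε ^ 2 := by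
  classical
  obtain ⟨K, D, hKD⟩ := kinetic_hasPolynomialTraces d s k c
  obtain ⟨C, hC0, hC⟩ := exists_approximation K D
  refine ⟨C, hC0, fun P hPfin hPne hP R hR ε hε hε1 => ?_⟩
  have : Fintype P := hPfin.fintype
  have : Nonempty P := hPne.to_subtype
  obtain ⟨B, hBne, hBcard, hB⟩ := hC (hKD P hP R hR) ε hε hε1
  have hdens : ∀ (B : Finset P) (r : Set (EuclideanSpace ℝ (Fin d))) (t : ℝ≥0),
      setDensity B {p : P | p.1 t ∈ r} = (({p ∈ P | p t ∈ r} ∩ (Subtype.val '' (B : Set P))).ncard : ℝ)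
        / ((Subtype.val '' (B : Set P)).ncard : ℝ) := by
    intro B r t
    rw [setDensity, Set.ncard_image_of_injective _ Subtype.val_injective, Set.ncard_coe_finset]
    congr 2
    have : {p ∈ P | p t ∈ r} ∩ (Subtype.val '' (B : Set P))
        = Subtype.val '' ((B.filter fun p : P => p ∈ {p : P | p.1 t ∈ r} : Finset P) : Set P) := by
      ext p
      simp only [Set.mem_inter_iff, Set.mem_ofPred_eq, Set.mem_image, Finset.mem_coe,
        Finset.mem_filter, Subtype.exists, exists_and_right, exists_eq_right]
      constructor
      · rintro ⟨⟨h1, h2⟩, h3, h4⟩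
        exact ⟨⟨h3, h4⟩, h2⟩
      · rintro ⟨⟨h3, h4⟩, h2⟩
        exact ⟨⟨h3, h2⟩, h3, h4⟩
    rw [this, Set.ncard_image_of_injective _ Subtype.val_injective, Set.ncard_coe_finset]
  refine ⟨Subtype.val '' (B : Set P), ⟨?_, ?_, ?_⟩, ?_⟩
  · rintro _ ⟨p, -, rfl⟩
    exact p.2
  · exact (Finset.coe_nonempty.2 hBne).image _
  · rintro S ⟨t, r, hr, rfl⟩
    have h := hB _ ⟨t, r, hr, rfl⟩
    rw [hdens B, hdens Finset.univ, Finset.coe_univ, Subtype.coe_image_univ] at h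
    exact h
  · rw [Set.ncard_image_of_injective _ Subtype.val_injective, Set.ncard_coe_finset]
    exact hBcard
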